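/- Fix the standard acceptable enumeration $(\varphi_e)_{e\in\mathbb N}$ of the partial computable functions on $\mathbb N$, let $W_e=\operatorname{dom}\varphi_e$, a computable pairing $\langle\cdot,\cdot\rangle$ of $\mathbb N\times\mathbb N$ with $\mathbb N$, and an effective coding of words by natural numbers. An index of a recursive presentation is a number $e=\langle i,j\rangle$ such that $\varphi_i$ is the (total) characteristic function of a set $X_e\subseteq\mathbb N$ and every element of $W_j$ is the code of a word in the letters $x^{\pm1}$, $x\in X_e$; it describes the group $G_e=\langle X_e\mid R_e\rangle$, where $R_e$ is the set of words with code in $W_j$. Let $A\subseteq\mathbb N$ be the set of these indices. A set $S\subseteq\mathbb N$ is $\Pi^0_2$ if for some computable relation $R\subseteq\mathbb N^3$ one has $e\in S\iff\forall x\,\exists y\,R(e,x,y)$. Detecting a property $P$ of groups is $\Pi^0_2$-complete in the class of recursively presented groups if 1. there is a $\Pi^0_2$ set $\Phi\subseteq\mathbb N$ with $\{e\in A : G_e \text{ has } P\}=A\cap\Phi$, and 2. for every $\Pi^0_2$ set $S\subseteq\mathbb N$ there is a computable function $f:\mathbb N\to A$ such that, for all $e\in\mathbb N$, $e\in S$ if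 and only if $G_{f(e)}$ has $P$. Theorem. Detecting each of the following properties of a group $G$ is $\Pi^0_2$-complete in the class of recursively presented groups: - $G$ is abelian; - $G$ is torsion-free (for all $g\in G$ and $n>0$, $g^n=1$ implies $g=1$); - $G$ is trivial; - $G$ is divisible (for all $g\in G$ and $n>0$ there is $h\in G$ with $h^n=g$; $G$ need not be abelian); - $G$ is a torsion group (for all $g\in G$ there is $n>0$ with $g^n=1$); - $G$ is totally left-orderable (there is a total order on $G$ with $g\le h\Rightarrow ag\le ah$ for all $a,g,h\in G$); - $G$ is totally bi-orderable (there is a total order on $G$ with $g\le h\Rightarrow ag\le ah$ and $ga\le ha$ for all $a,g,h\in G$). -/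

import Mathlib

/-- The `e`-th partial computable function on the natural numbers, in the standard (acceptable)
enumeration of codes of partial recursive functions. -/
def phi (e : ℕ) : ℕ →. ℕ :=
  (Denumerable.ofNat Nat.Partrec.Code e).eval

/-- The `e`-th computably enumerable set, the domain of `phi e`. -/
def ceSet (e : ℕ) : Set ℕ :=
  {n | (phi e n).Dom}

/-- `S ⊆ ℕ` is `Π⁰₂`: for some computable ternary relation `R`,
`e ∈ S` if and only if for all `x` there is `y` with `R e x y`. -/
def IsPiZeroTwo (S : Set ℕ) : Prop :=
  ∃ R : ℕ × ℕ × ℕ → Prop, ComputablePred R ∧ ∀ e, e ∈ S ↔ ∀ x, ∃ y, R (e, x, y)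

/-- The generators of the presentation with index `e = ⟨i, j⟩`: the set whose characteristic
function is `phi i`. -/
def presGenerators (e : ℕ) : Set ℕ :=
  {n | 1 ∈ phi e.unpair.1 n}

/-- The natural number coding a word in the generators and their inverses; the letter
`(x, true)` stands for `x`, and `(x, false)` for its inverse. -/
def wordCode {X : Set ℕ} (w : List (X × Bool)) : ℕ :=
  Encodable.encode (w.map fun l => ((l.1 : ℕ), l.2))

/-- `e = ⟨i, j⟩` is an index of a recursive presentation: `phi i` is the characteristic function
of a (computable) set of generators, and the c.e. set with index `j` consists of (codes of) words
in these generators and their inverses, the relators. -/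
def IsRecursivePresentation (e : ℕ) : Prop :=
  (∀ n, 0 ∈ phi e.unpair.1 n ∨ 1 ∈ phi e.unpair.1 n) ∧
    ∀ m ∈ ceSet e.unpair.2, ∃ w : List (presGenerators e × Bool), wordCode w = m

/-- The relators of the presentation with index `e`, as elements of the free group on its
generators. -/
def presRelators (e : ℕ) : Set (FreeGroup (presGenerators e)) :=
  {r | ∃ w : List (presGenerators e × Bool), wordCode w ∈ ceSet e.unpair.2 ∧ r = FreeGroup.mk w}

/-- The group given by the presentation with index `e`. -/
abbrev PresGroup (e : ℕ) : Type :=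
  PresentedGroup (presRelators e)

/-- Detecting the property `P` of groups is `Π⁰₂` in the class of recursively presented groups. -/
def DetectionIsPiZeroTwo (P : (G : Type) → [Group G] → Prop) : Prop :=
  ∃ S : Set ℕ, IsPiZeroTwo S ∧ ∀ e, IsRecursivePresentation e → (P (PresGroup e) ↔ e ∈ S)

/-- Detecting the property `P` of groups is `Π⁰₂`-hard in the class of recursively presented
groups. -/
def DetectionIsPiZeroTwoHard (P : (G : Type) → [Group G] → Prop) : Prop :=
  ∀ S : Set ℕ, IsPiZeroTwo S → ∃ f : ℕ → ℕ, Computable f ∧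
    (∀ e, IsRecursivePresentation (f e)) ∧ ∀ e, e ∈ S ↔ P (PresGroup (f e))

/-- Detecting the property `P` of groups is `Π⁰₂`-complete in the class of recursively presented
groups. -/
def DetectionIsPiZeroTwoComplete (P : (G : Type) → [Group G] → Prop) : Prop :=
  DetectionIsPiZeroTwo P ∧ DetectionIsPiZeroTwoHard P

/-- `G` is abelian. -/
def GroupIsAbelian (G : Type) [Group G] : Prop :=
  ∀ a b : G, a * b = b * a

/-- `G` is torsion-free: only the identity has finite order. (For non-commutative groups this is
weaker than injectivity of the power maps.) -/
def GroupIsTorsionFree (G : Type) [Group G] : Prop :=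
  ∀ g : G, ∀ n : ℕ, 0 < n → g ^ n = 1 → g = 1

/-- `G` is trivial. -/
def GroupIsTrivial (G : Type) [Group G] : Prop :=
  ∀ g : G, g = 1

/-- `G` is divisible: every element has an `n`-th root for every positive `n`. -/
def GroupIsDivisible (G : Type) [Group G] : Prop :=
  ∀ g : G, ∀ n : ℕ, 0 < n → ∃ h : G, h ^ n = g

/-- `G` is a torsion group: every element has finite order. -/
def GroupIsTorsion (G : Type) [Group G] : Prop :=
  ∀ g : G, ∃ n : ℕ, 0 < n ∧ g ^ n = 1

/-- `G` is totally left-orderable: it admits a left-invariant total order. -/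
def GroupIsLeftOrderable (G : Type) [Group G] : Prop :=
  ∃ _ : LinearOrder G, ∀ a g h : G, g ≤ h → a * g ≤ a * h

/-- `G` is totally bi-orderable: it admits a total order invariant under multiplication on both
sides. -/
def GroupIsBiOrderable (G : Type) [Group G] : Prop :=
  ∃ _ : LinearOrder G, ∀ a g h : G, g ≤ h → a * g ≤ a * h ∧ g * a ≤ h * a

/-! Upper bounds. Uniformly in the index, the word problem is `Σ⁰₁`: a word is trivial iff it is
freely equal to a product of conjugates of relators and their inverses (`isSigmaOne_isConsequence`,
`IsRecursivePresentation.isConsequence_iff`). A statement "for all `b`, if `p` then `q`" with `p`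
and `q` both `Σ⁰₁` is `Π⁰₂` (`isPiZeroTwo_forall_imp`). All the properties except the two
orderability ones take this form at once, quantifying over words in place of group elements.

Orderability asks for a positive cone, a second-order object. By compactness (`exists_isConeFor`) a
cone exists iff every finite set of nontrivial elements admits a choice of signs for which no
nonempty product of the chosen elements (of their conjugates, for bi-orders) is trivial.
Contrapositively: if every choice of signs yields a trivial product, then the finite set already
contains the identity. Both sides of this implication are `Σ⁰₁`.

Hardness. One reduction serves every property. Given `S = {e | ∀ x, ∃ y, R (e, x, y)}`, attach to
each `x` a free generator `2x` and an involution `2x + 1`, and kill both once some `y` is found. If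
`e ∈ S` the group is trivial; otherwise it is a nontrivial free product of copies of `ℤ * ℤ/2`,
which is nonabelian, has torsion, is not a torsion group and is not divisible. Only the mapping
property of one surviving pair is used (`detectionIsPiZeroTwoHard_of_universal`), so no normal forms
in free products are needed. -/

/-! ### Semidecidable predicates with primitive recursive witnesses -/

/-- `p` is `Σ⁰₁`: it is the projection of a primitive recursive relation. -/
def IsSigmaOne {α : Type} [Primcodable α] (p : α → Prop) : Prop :=
  ∃ R : α × ℕ → Prop, PrimrecPred R ∧ ∀ a, p a ↔ ∃ y, R (a, y)

theorem PrimrecPred.of_primrec {α : Type} [Primcodable α] {f : α → Bool} (hf : Primrec f) :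
    PrimrecPred fun a => f a = true :=
  Primrec.eq.comp hf (Primrec.const true)

theorem PrimrecRel.exists_lt_nat {α : Type} [Primcodable α] {R : ℕ → α → Prop}
    (hR : PrimrecRel R) : PrimrecRel fun (n : ℕ) (a : α) => ∃ x < n, R x a :=
  (PrimrecRel.comp (f := fun a : ℕ × α => List.range a.1) (g := fun a => a.2)
    hR.exists_mem_list (Primrec.list_range.comp Primrec.fst) Primrec.snd).of_eq (by simp)

/-- A primitive recursive predicate holding of the object coded by a natural number. -/
theorem PrimrecPred.decode_exists {α β : Type} [Primcodable α] [Primcodable β]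
    {p : α × β → Prop} (hp : PrimrecPred p) :
    PrimrecPred fun a : α × ℕ => ∃ b ∈ (Encodable.decode a.2 : Option β), p (a.1, b) := by
  classical
  obtain ⟨d, h⟩ := hp
  have : Primrec fun a : α × ℕ =>
      Option.casesOn (motive := fun _ => Bool) (Encodable.decode a.2 : Option β) false
        fun b => decide (p (a.1, b)) :=
    Primrec.option_casesOn (Primrec.decode.comp Primrec.snd) (Primrec.const false)
      (h.comp (Primrec.pair (Primrec.fst.comp Primrec.fst) Primrec.snd)).to₂
  refine (PrimrecPred.of_primrec this).of_eq fun a => ?_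
  cases (Encodable.decode a.2 : Option β) <;> simp

namespace IsSigmaOne

variable {α β : Type} [Primcodable α] [Primcodable β]

theorem of_eq {p q : α → Prop} (hp : IsSigmaOne p) (h : ∀ a, p a ↔ q a) : IsSigmaOne q := by
  obtain ⟨R, hR, hpR⟩ := hp
  exact ⟨R, hR, fun a => (h a).symm.trans (hpR a)⟩

theorem of_primrecPred {p : α → Prop} (hp : PrimrecPred p) : IsSigmaOne p :=
  ⟨fun a => p a.1, hp.comp Primrec.fst, fun _ => by simp⟩

theorem comp {p : β → Prop} (hp : IsSigmaOne p) {f : α → β} (hf : Primrec f) :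
    IsSigmaOne fun a => p (f a) := by
  obtain ⟨R, hR, hpR⟩ := hp
  exact ⟨fun a => R (f a.1, a.2),
    hR.comp (Primrec.pair (hf.comp Primrec.fst) Primrec.snd), fun a => hpR (f a)⟩

theorem exists_of_primrecPred {p : α × β → Prop} (hp : PrimrecPred p) :
    IsSigmaOne fun a => ∃ b, p (a, b) := by
  refine ⟨_, hp.decode_exists, fun a => ⟨?_, ?_⟩⟩
  · rintro ⟨b, hb⟩
    exact ⟨Encodable.encode b, b, by simp, hb⟩
  · rintro ⟨y, b, -, hb⟩
    exact ⟨b, hb⟩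

theorem exists_snd {p : α × β → Prop} (hp : IsSigmaOne p) :
    IsSigmaOne fun a => ∃ b, p (a, b) := by
  obtain ⟨R, hR, hpR⟩ := hp
  have : PrimrecPred fun a : α × β × ℕ => R ((a.1, a.2.1), a.2.2) :=
    hR.comp (Primrec.pair (Primrec.pair Primrec.fst (Primrec.fst.comp Primrec.snd))
      (Primrec.snd.comp Primrec.snd))
  refine (exists_of_primrecPred this).of_eq fun a => ?_
  simp [hpR]

theorem and {p q : α → Prop} (hp : IsSigmaOne p) (hq : IsSigmaOne q) :
    IsSigmaOne fun a => p a ∧ q a := by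
  obtain ⟨R, hR, hpR⟩ := hp
  obtain ⟨T, hT, hqT⟩ := hq
  have : PrimrecPred fun a : α × ℕ × ℕ => R (a.1, a.2.1) ∧ T (a.1, a.2.2) :=
    (hR.comp (Primrec.pair Primrec.fst (Primrec.fst.comp Primrec.snd))).and
      (hT.comp (Primrec.pair Primrec.fst (Primrec.snd.comp Primrec.snd)))
  refine (exists_of_primrecPred this).of_eq fun a => ?_
  simp [hpR, hqT]

theorem exists_mem_list {p : α × β → Prop} (hp : IsSigmaOne p) {l : α → List β}
    (hl : Primrec l) : IsSigmaOne fun a => ∃ b ∈ l a, p (a, b) := by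
  have hm : PrimrecPred fun a : α × β => ∃ c ∈ l a.1, c = a.2 :=
    PrimrecRel.comp (PrimrecRel.exists_mem_list (Primrec.eq (α := β)))
      (hl.comp Primrec.fst) Primrec.snd
  refine ((of_primrecPred hm).and hp).exists_snd.of_eq fun a => ?_
  simp

/-- The finitely many witnesses have a common bound, and with that bound as the single existential
witness only bounded quantifiers remain. -/
theorem forall_mem_list {p : α × β → Prop} (hp : IsSigmaOne p) {l : α → List β}
    (hl : Primrec l) : IsSigmaOne fun a => ∀ b ∈ l a, p (a, b) := by
  obtain ⟨R, hR, hpR⟩ := hp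
  have h1 : PrimrecRel fun (y : ℕ) (c : α × β) => R (c, y) :=
    hR.comp (Primrec.pair Primrec.snd Primrec.fst)
  have h2 : PrimrecRel fun (b : β) (c : α × ℕ) => ∃ y < c.2, R ((c.1, b), y) :=
    PrimrecRel.comp (f := fun a : β × α × ℕ => a.2.2) (g := fun a => (a.2.1, a.1))
      h1.exists_lt_nat (Primrec.snd.comp Primrec.snd)
      (Primrec.pair (Primrec.fst.comp Primrec.snd) Primrec.fst)
  refine ⟨fun c => ∀ b ∈ l c.1, ∃ y < c.2, R ((c.1, b), y),
    h2.forall_mem_list.comp (hl.comp Primrec.fst) Primrec.id, fun a => ⟨fun h => ?_, ?_⟩⟩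
  · simp only [hpR] at h
    choose! f hf using h
    -- The sum of the witnesses dominates each of them; the `+ 1` makes the bound strict.
    exact ⟨((l a).map f).sum + 1, fun b hb => ⟨f b, Nat.lt_succ_of_le
      (List.le_sum_of_mem (List.mem_map_of_mem hb)), hf b hb⟩⟩
  · rintro ⟨N, hN⟩ b hb
    obtain ⟨y, -, hy⟩ := hN b hb
    exact (hpR _).2 ⟨y, hy⟩

end IsSigmaOne

/-- A witness `z` for the premise moves out as a universal quantifier. So `x` runs over codes of
pairs `(b, z)`, and `y` is a witness for `q` whenever `z` really witnesses `p`; numbers that code no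
pair impose nothing. -/
theorem isPiZeroTwo_forall_imp {β : Type} [Primcodable β] {p q : ℕ × β → Prop}
    (hp : IsSigmaOne p) (hq : IsSigmaOne q) :
    IsPiZeroTwo {e | ∀ b, p (e, b) → q (e, b)} := by
  obtain ⟨R, hR, hpR⟩ := hp
  obtain ⟨T, hT, hqT⟩ := hq
  have h : PrimrecPred fun a : (ℕ × ℕ) × β × ℕ =>
      R ((a.1.1, a.2.1), a.2.2) ∧ ¬ T ((a.1.1, a.2.1), a.1.2) := by
    have he : Primrec fun a : (ℕ × ℕ) × β × ℕ => (a.1.1, a.2.1) :=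
      Primrec.pair (Primrec.fst.comp Primrec.fst) (Primrec.fst.comp Primrec.snd)
    exact (hR.comp (Primrec.pair he (Primrec.snd.comp Primrec.snd))).and
      (hT.comp (Primrec.pair he (Primrec.snd.comp Primrec.fst))).not
  have h' := (h.decode_exists.comp (f := fun a : ℕ × ℕ × ℕ => ((a.1, a.2.2), a.2.1))
    (Primrec.pair (Primrec.pair Primrec.fst (Primrec.snd.comp Primrec.snd))
      (Primrec.fst.comp Primrec.snd))).not
  refine ⟨_, h'.computablePred, fun e => ⟨fun he x => ?_, fun he b hb => ?_⟩⟩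
  · rcases hx : (Encodable.decode x : Option (β × ℕ)) with _ | ⟨b, z⟩
    · simp [hx]
    · by_cases hz : R ((e, b), z)
      · obtain ⟨y, hy⟩ := (hqT _).1 (he b ((hpR _).2 ⟨z, hz⟩))
        exact ⟨y, by simp [hx, hy]⟩
      · exact ⟨0, by simp [hx, hz]⟩
  · obtain ⟨z, hz⟩ := (hpR _).1 hb
    obtain ⟨y, hy⟩ := he (Encodable.encode (b, z))
    refine (hqT _).2 ⟨y, ?_⟩
    by_contra hn
    exact hy ⟨(b, z), by simp, hz, hn⟩

theorem isPiZeroTwo_forall {β : Type} [Primcodable β] {q : ℕ × β → Prop}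
    (hq : IsSigmaOne q) : IsPiZeroTwo {e | ∀ b, q (e, b)} := by
  have hp : PrimrecPred fun _ : ℕ × β => True := PrimrecPred.of_eq
    (PrimrecPred.of_primrec (Primrec.const true)) (by simp)
  simpa using isPiZeroTwo_forall_imp (IsSigmaOne.of_primrecPred hp) hq

/-! ### Words in the letters `n`, `n⁻¹` for `n : ℕ` -/

/-- Words in the natural numbers and their formal inverses. -/
abbrev NatWord : Type := List (ℕ × Bool)

namespace NatWord

theorem primrec_invRev : Primrec (FreeGroup.invRev : NatWord → NatWord) := by
  have h : Primrec₂ fun (_ : NatWord) (l : ℕ × Bool) => (l.1, !l.2) :=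
    (Primrec.pair (Primrec.fst.comp Primrec.snd)
      (Primrec.not.comp (Primrec.snd.comp Primrec.snd))).to₂
  exact Primrec.list_reverse.comp (Primrec.list_map Primrec.id h)

/-- One step of the reduction algorithm: put a letter before a reduced word. -/
def consReduce (a : ℕ × Bool) (w : NatWord) : NatWord :=
  List.casesOn w [a] fun hd tl => if a.1 = hd.1 ∧ a.2 = !hd.2 then tl else a :: hd :: tl

/-- As a fold, free reduction is visibly primitive recursive. -/
theorem reduce_eq_foldr (w : NatWord) : FreeGroup.reduce w = w.foldr consReduce [] := by
  induction w with
  | nil => rfl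
  | cons a w ih => rw [List.foldr_cons, ← ih]; rfl

theorem primrec_consReduce : Primrec₂ consReduce := by
  have hc : PrimrecPred fun x : ((ℕ × Bool) × NatWord) × (ℕ × Bool) × NatWord =>
      x.1.1.1 = x.2.1.1 ∧ x.1.1.2 = !x.2.1.2 :=
    (Primrec.eq.comp (Primrec.fst.comp (Primrec.fst.comp Primrec.fst))
      (Primrec.fst.comp (Primrec.fst.comp Primrec.snd))).and
    (Primrec.eq.comp (Primrec.snd.comp (Primrec.fst.comp Primrec.fst))
      (Primrec.not.comp (Primrec.snd.comp (Primrec.fst.comp Primrec.snd))))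
  have h1 : Primrec fun x : ((ℕ × Bool) × NatWord) × (ℕ × Bool) × NatWord =>
      if x.1.1.1 = x.2.1.1 ∧ x.1.1.2 = !x.2.1.2 then x.2.2 else x.1.1 :: x.2.1 :: x.2.2 :=
    Primrec.ite hc (Primrec.snd.comp Primrec.snd)
      (Primrec.list_cons.comp (Primrec.fst.comp Primrec.fst)
        (Primrec.list_cons.comp (Primrec.fst.comp Primrec.snd) (Primrec.snd.comp Primrec.snd)))
  have h0 : Primrec fun x : (ℕ × Bool) × NatWord => [x.1] :=
    Primrec.list_cons.comp Primrec.fst (Primrec.const [])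
  exact Primrec.list_casesOn Primrec.snd h0 h1.to₂

theorem primrec_reduce : Primrec (FreeGroup.reduce : NatWord → NatWord) := by
  have h : Primrec₂ fun (_ : NatWord) (x : (ℕ × Bool) × NatWord) => consReduce x.1 x.2 :=
    (primrec_consReduce.comp (Primrec.fst.comp Primrec.snd) (Primrec.snd.comp Primrec.snd)).to₂
  exact (Primrec.list_foldr Primrec.id (Primrec.const []) h).of_eq fun w =>
    (reduce_eq_foldr w).symm

/-- The `n`-th power of a word. -/
def pow (w : NatWord) (n : ℕ) : NatWord := n.rec [] fun _ v => w ++ v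

theorem primrec_pow : Primrec₂ pow :=
  Primrec.nat_rec (Primrec.const []) (g := fun w (x : ℕ × NatWord) => w ++ x.2)
    (Primrec.list_append.comp Primrec.fst (Primrec.snd.comp Primrec.snd)).to₂

theorem mk_pow (w : NatWord) (n : ℕ) : FreeGroup.mk (pow w n) = FreeGroup.mk w ^ n := by
  induction n with
  | zero => rfl
  | succ n ih => rw [pow_succ', ← ih, FreeGroup.mul_mk]; rfl

/-- The conjugate of the second word by the first. -/
def conj (u w : NatWord) : NatWord := u ++ w ++ FreeGroup.invRev u

theorem primrec_conj : Primrec₂ conj :=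
  (Primrec.list_append.comp (Primrec.list_append.comp Primrec.fst Primrec.snd)
    (primrec_invRev.comp Primrec.fst)).to₂

theorem mk_conj (u w : NatWord) :
    FreeGroup.mk (conj u w) = FreeGroup.mk u * FreeGroup.mk w * (FreeGroup.mk u)⁻¹ := by
  rw [FreeGroup.inv_mk, FreeGroup.mul_mk, FreeGroup.mul_mk]; rfl

end NatWord

/-! ### The word problem of a recursive presentation -/

section WordProblem

open Nat.Partrec Nat.Partrec.Code

/-- `w` is recognized within `s` steps as a relator of the presentation with index `e`, or as a
single letter which is not a generator. -/
def IsRelatorAt (e s : ℕ) (w : NatWord) : Prop :=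
  (evaln s (Denumerable.ofNat Code e.unpair.2) (Encodable.encode w)).isSome = true ∨
    ∃ n < s, w = [(n, true)] ∧ evaln s (Denumerable.ofNat Code e.unpair.1) n = some 0

theorem primrecPred_isRelatorAt :
    PrimrecPred fun x : ℕ × ℕ × NatWord => IsRelatorAt x.1 x.2.1 x.2.2 := by
  have hs : Primrec fun x : ℕ × ℕ × NatWord => x.2.1 := Primrec.fst.comp Primrec.snd
  have hw : Primrec fun x : ℕ × ℕ × NatWord => x.2.2 := Primrec.snd.comp Primrec.snd
  have h1 : Primrec fun x : ℕ × ℕ × NatWord => Denumerable.ofNat Code x.1.unpair.1 :=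
    (Primrec.ofNat Code).comp (Primrec.fst.comp (Primrec.unpair.comp Primrec.fst))
  have h2 : Primrec fun x : ℕ × ℕ × NatWord => Denumerable.ofNat Code x.1.unpair.2 :=
    (Primrec.ofNat Code).comp (Primrec.snd.comp (Primrec.unpair.comp Primrec.fst))
  have h3 : PrimrecRel fun (n : ℕ) (x : ℕ × ℕ × NatWord) => x.2.2 = [(n, true)] ∧
      evaln x.2.1 (Denumerable.ofNat Code x.1.unpair.1) n = some 0 :=
    PrimrecPred.and
      (Primrec.eq.comp (hw.comp Primrec.snd) (Primrec.list_cons.comp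
        (Primrec.pair Primrec.fst (Primrec.const true)) (Primrec.const [])))
      (Primrec.eq.comp (primrec_evaln.comp (Primrec.pair (Primrec.pair
        (hs.comp Primrec.snd) (h1.comp Primrec.snd)) Primrec.fst)) (Primrec.const (some 0)))
  exact (PrimrecPred.of_primrec (Primrec.option_isSome.comp (primrec_evaln.comp
      (Primrec.pair (Primrec.pair hs h2) (Primrec.encode.comp hw))))).or
    (PrimrecRel.comp h3.exists_lt_nat hs Primrec.id)

/-- The product of the conjugates `u r u⁻¹` (for sign `true`) or `u r⁻¹ u⁻¹` (for sign `false`)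
given by a list of triples `(u, r, sign)`. -/
def conjProd (c : List (NatWord × NatWord × Bool)) : NatWord :=
  (c.map fun x => NatWord.conj x.1 (cond x.2.2 x.2.1 (FreeGroup.invRev x.2.1))).flatten

theorem primrec_conjProd : Primrec conjProd := by
  have h : Primrec fun x : NatWord × NatWord × Bool =>
      NatWord.conj x.1 (cond x.2.2 x.2.1 (FreeGroup.invRev x.2.1)) :=
    NatWord.primrec_conj.comp Primrec.fst (Primrec.cond (Primrec.snd.comp Primrec.snd)
      (Primrec.fst.comp Primrec.snd)
      (NatWord.primrec_invRev.comp (Primrec.fst.comp Primrec.snd)))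
  exact Primrec.list_flatten.comp (Primrec.list_map Primrec.id (h.comp Primrec.snd).to₂)

/-- The word `w` is a consequence of the relators of the presentation with index `e`. -/
def IsConsequence (x : ℕ × NatWord) : Prop :=
  ∃ c : ℕ × List (NatWord × NatWord × Bool),
    (∀ t ∈ c.2, IsRelatorAt x.1 c.1 t.2.1) ∧
      FreeGroup.reduce x.2 = FreeGroup.reduce (conjProd c.2)

theorem isSigmaOne_isConsequence : IsSigmaOne IsConsequence := by
  have h1 : PrimrecRel fun (t : NatWord × NatWord × Bool) (y : ℕ × ℕ) =>
      IsRelatorAt y.1 y.2 t.2.1 :=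
    primrecPred_isRelatorAt.comp (Primrec.pair (Primrec.fst.comp Primrec.snd)
      (Primrec.pair (Primrec.snd.comp Primrec.snd)
        (Primrec.fst.comp (Primrec.snd.comp Primrec.fst))))
  have h2 : PrimrecPred fun z : (ℕ × NatWord) × ℕ × List (NatWord × NatWord × Bool) =>
      (∀ t ∈ z.2.2, IsRelatorAt z.1.1 z.2.1 t.2.1) ∧
        FreeGroup.reduce z.1.2 = FreeGroup.reduce (conjProd z.2.2) :=
    (PrimrecRel.comp (f := fun z : (ℕ × NatWord) × ℕ × List (NatWord × NatWord × Bool) => z.2.2)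
      (g := fun z => (z.1.1, z.2.1)) h1.forall_mem_list (Primrec.snd.comp Primrec.snd)
      (Primrec.pair (Primrec.fst.comp Primrec.fst) (Primrec.fst.comp Primrec.snd))).and
    (Primrec.eq.comp (NatWord.primrec_reduce.comp (Primrec.snd.comp Primrec.fst))
      (NatWord.primrec_reduce.comp (primrec_conjProd.comp (Primrec.snd.comp Primrec.snd))))
  exact IsSigmaOne.exists_of_primrecPred h2

end WordProblem

/-! ### Consequences of the relators as the kernel of evaluation. -/

section EvalHom

open Nat.Partrec Nat.Partrec.Code

theorem IsRelatorAt.mono {e s t : ℕ} {w : NatWord} (h : IsRelatorAt e s w) (hst : s ≤ t) :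
    IsRelatorAt e t w := by
  refine h.imp (fun h => ?_) fun ⟨n, hn, hw, h⟩ => ⟨n, hn.trans_le hst, hw, evaln_mono hst h⟩
  obtain ⟨y, hy⟩ := Option.isSome_iff_exists.1 h
  exact Option.isSome_iff_exists.2 ⟨y, evaln_mono hst hy⟩

theorem exists_isRelatorAt_iff {e : ℕ} {w : NatWord} :
    (∃ s, IsRelatorAt e s w) ↔
      Encodable.encode w ∈ ceSet e.unpair.2 ∨ ∃ n, w = [(n, true)] ∧ 0 ∈ phi e.unpair.1 n := by
  constructor
  · rintro ⟨s, h | ⟨n, -, hw, h⟩⟩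
    · obtain ⟨y, hy⟩ := Option.isSome_iff_exists.1 h
      exact Or.inl (Part.dom_iff_mem.2 ⟨y, evaln_sound hy⟩)
    · exact Or.inr ⟨n, hw, evaln_sound h⟩
  · rintro (h | ⟨n, hw, h⟩)
    · obtain ⟨y, hy⟩ := Part.dom_iff_mem.1 h
      obtain ⟨s, hs⟩ := evaln_complete.1 hy
      exact ⟨s, Or.inl (Option.isSome_iff_exists.2 ⟨y, hs⟩)⟩
    · obtain ⟨s, hs⟩ := evaln_complete.1 h
      -- `evaln s` returns values only on inputs below `s`, so the bound `n < s` loses nothing.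
      exact ⟨s, Or.inr ⟨n, evaln_bound hs, hw, hs⟩⟩

theorem mk_conjProd_cons (x : NatWord × NatWord × Bool) (c : List (NatWord × NatWord × Bool)) :
    FreeGroup.mk (conjProd (x :: c)) =
      FreeGroup.mk x.1 * cond x.2.2 (FreeGroup.mk x.2.1) (FreeGroup.mk x.2.1)⁻¹ *
        (FreeGroup.mk x.1)⁻¹ * FreeGroup.mk (conjProd c) := by
  rw [show conjProd (x :: c) = NatWord.conj x.1 (cond x.2.2 x.2.1 (FreeGroup.invRev x.2.1)) ++
    conjProd c from rfl, ← FreeGroup.mul_mk, NatWord.mk_conj]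
  rcases x with ⟨u, r, _ | _⟩
  · rw [FreeGroup.inv_mk (L := r)]; rfl
  · rfl

theorem mk_conjProd_mem {N : Subgroup (FreeGroup ℕ)} [N.Normal]
    {c : List (NatWord × NatWord × Bool)} (h : ∀ t ∈ c, FreeGroup.mk t.2.1 ∈ N) :
    FreeGroup.mk (conjProd c) ∈ N := by
  induction c with
  | nil => exact N.one_mem
  | cons x c ih =>
    rw [mk_conjProd_cons]
    refine N.mul_mem (Subgroup.Normal.conj_mem ‹_› _ ?_ _)
      (ih fun t ht => h t (List.mem_cons_of_mem _ ht))
    have := h x List.mem_cons_self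
    cases x.2.2
    · exact N.inv_mem this
    · exact this

/-- The normal subgroup of the free group on `ℕ` generated by the relators of the presentation
with index `e` and the numbers which are not generators. -/
def consequences (e : ℕ) : Subgroup (FreeGroup ℕ) :=
  Subgroup.normalClosure {g | ∃ w, (∃ s, IsRelatorAt e s w) ∧ g = FreeGroup.mk w}

instance (e : ℕ) : (consequences e).Normal := Subgroup.normalClosure_normal

theorem mk_mem_consequences {e : ℕ} {w : NatWord} (h : ∃ s, IsRelatorAt e s w) :
    FreeGroup.mk w ∈ consequences e :=
  Subgroup.subset_normalClosure ⟨w, h, rfl⟩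

/-- The normal closure is the subgroup generated by the conjugates, so its elements are built by
multiplying on the left by one conjugate or its inverse at a time. Recognition stages are monotone,
and their maximum serves the whole list. -/
theorem exists_conjProd_of_mem_consequences {e : ℕ} {g : FreeGroup ℕ} (hg : g ∈ consequences e) :
    ∃ s c, (∀ t ∈ c, IsRelatorAt e s t.2.1) ∧ g = FreeGroup.mk (conjProd c) := by
  have key : ∀ x ∈ Group.conjugatesOfSet {g | ∃ w, (∃ s, IsRelatorAt e s w) ∧ g = FreeGroup.mk w},
      ∀ (y : FreeGroup ℕ) (b : Bool),
      (∃ s c, (∀ t ∈ c, IsRelatorAt e s t.2.1) ∧ y = FreeGroup.mk (conjProd c)) →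
      ∃ s c, (∀ t ∈ c, IsRelatorAt e s t.2.1) ∧ cond b x x⁻¹ * y = FreeGroup.mk (conjProd c) := by
    rintro x hx y b ⟨s, c, hc, rfl⟩
    obtain ⟨_, ⟨w, ⟨t, ht⟩, rfl⟩, hconj⟩ := Group.mem_conjugatesOfSet_iff.1 hx
    obtain ⟨u, rfl⟩ := isConj_iff.1 hconj
    refine ⟨max s t, (u.toWord, w, b) :: c, ?_, ?_⟩
    · intro z hz
      rcases List.mem_cons.1 hz with rfl | hz
      · exact ht.mono (le_max_right _ _)
      · exact (hc z hz).mono (le_max_left _ _)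
    · rw [mk_conjProd_cons, FreeGroup.mk_toWord]
      cases b <;> simp [mul_assoc]
  refine Subgroup.closure_induction_left ⟨0, [], by simp, rfl⟩
    (fun x hx y _ ih => key x hx y true ih) (fun x hx y _ ih => key x hx y false ih) hg

theorem isConsequence_iff {e : ℕ} {w : NatWord} :
    IsConsequence (e, w) ↔ FreeGroup.mk w ∈ consequences e := by
  constructor
  · rintro ⟨⟨s, c⟩, hc, h⟩
    rw [FreeGroup.reduce.exact h]
    exact mk_conjProd_mem fun t ht => mk_mem_consequences ⟨s, hc t ht⟩
  · intro h
    obtain ⟨s, c, hc, h⟩ := exists_conjProd_of_mem_consequences h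
    exact ⟨(s, c), hc, FreeGroup.reduce.sound h⟩

open scoped Classical in
/-- The homomorphism onto the group with index `e` which is the identity on its generators and
kills all other numbers. -/
noncomputable def evalHom (e : ℕ) : FreeGroup ℕ →* PresGroup e :=
  FreeGroup.lift fun n =>
    if h : n ∈ presGenerators e then PresentedGroup.of ⟨n, h⟩ else 1

theorem evalHom_of {e n : ℕ} (h : n ∈ presGenerators e) :
    evalHom e (FreeGroup.of n) = PresentedGroup.of ⟨n, h⟩ := by
  rw [evalHom, FreeGroup.lift_apply_of, dif_pos h]

theorem evalHom_of_eq_one {e n : ℕ} (h : n ∉ presGenerators e) :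
    evalHom e (FreeGroup.of n) = 1 := by
  rw [evalHom, FreeGroup.lift_apply_of, dif_neg h]

theorem evalHom_map_val (e : ℕ) (g : FreeGroup (presGenerators e)) :
    evalHom e (FreeGroup.map Subtype.val g) = PresentedGroup.mk (presRelators e) g := by
  have : (evalHom e).comp (FreeGroup.map Subtype.val) = PresentedGroup.mk (presRelators e) := by
    ext x
    rw [MonoidHom.comp_apply, FreeGroup.map.of]
    exact evalHom_of x.2
  exact DFunLike.congr_fun this g

theorem evalHom_surjective (e : ℕ) : Function.Surjective (evalHom e) := by
  intro g
  obtain ⟨x, rfl⟩ := PresentedGroup.mk_surjective _ g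
  exact ⟨_, evalHom_map_val e x⟩

/-- Killing the non-generators lets words over all of `ℕ` represent the elements of every presented
group, so the type of words does not depend on `e`. Totality of the characteristic function makes
each non-generator a recognized relator. -/
theorem IsRecursivePresentation.consequences_eq_ker {e : ℕ} (he : IsRecursivePresentation e) :
    consequences e = (evalHom e).ker := by
  apply le_antisymm
  · refine Subgroup.normalClosure_le_normal ?_
    rintro _ ⟨w, hw, rfl⟩
    rw [SetLike.mem_coe, MonoidHom.mem_ker]
    rcases exists_isRelatorAt_iff.1 hw with hw | ⟨n, rfl, hn⟩
    · obtain ⟨v, hv⟩ := he.2 _ hw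
      obtain rfl := Encodable.encode_injective hv
      have := evalHom_map_val e (FreeGroup.mk v)
      rw [FreeGroup.map.mk] at this
      exact this.trans (PresentedGroup.one_of_mem ⟨v, hv ▸ hw, rfl⟩)
    · refine evalHom_of_eq_one fun h => ?_
      exact absurd (Part.mem_unique hn h) zero_ne_one
  · have hlift : ∀ g : FreeGroup (presGenerators e),
        FreeGroup.lift (fun x => QuotientGroup.mk' (consequences e) (FreeGroup.of x.1)) g =
          QuotientGroup.mk' (consequences e) (FreeGroup.map Subtype.val g) := by
      intro g
      rw [← MonoidHom.comp_apply]
      congr 1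
      ext x
      simp
    have hrel : ∀ r ∈ presRelators e,
        FreeGroup.lift (fun x => QuotientGroup.mk' (consequences e) (FreeGroup.of x.1)) r = 1 := by
      rintro _ ⟨w, hw, rfl⟩
      rw [hlift, FreeGroup.map.mk]
      exact (QuotientGroup.eq_one_iff _).2
        (mk_mem_consequences (exists_isRelatorAt_iff.2 (Or.inl hw)))
    -- The quotient by `consequences e` factors through `evalHom e`, so whatever evaluation kills is
    -- a consequence.
    have hcomp : (PresentedGroup.toGroup hrel).comp (evalHom e) =
        QuotientGroup.mk' (consequences e) := by
      ext n
      by_cases hn : n ∈ presGenerators e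
      · rw [MonoidHom.comp_apply, evalHom_of hn, PresentedGroup.toGroup.of]
      · rw [MonoidHom.comp_apply, evalHom_of_eq_one hn, map_one]
        exact ((QuotientGroup.eq_one_iff _).2 (mk_mem_consequences
          (exists_isRelatorAt_iff.2 (Or.inr ⟨n, rfl, (he.1 n).resolve_right hn⟩)))).symm
    intro g hg
    have := DFunLike.congr_fun hcomp g
    rw [MonoidHom.comp_apply, MonoidHom.mem_ker.1 hg, map_one] at this
    exact (QuotientGroup.eq_one_iff g).1 this.symm

/-- The element of the group with index `e` represented by a word. -/
noncomputable def evalWord (e : ℕ) (w : NatWord) : PresGroup e := evalHom e (FreeGroup.mk w)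

theorem IsRecursivePresentation.isConsequence_iff {e : ℕ} (he : IsRecursivePresentation e)
    {w : NatWord} : IsConsequence (e, w) ↔ evalWord e w = 1 := by
  rw [_root_.isConsequence_iff, he.consequences_eq_ker, MonoidHom.mem_ker, evalWord]

theorem evalWord_surjective (e : ℕ) : Function.Surjective (evalWord e) := by
  intro g
  obtain ⟨x, rfl⟩ := evalHom_surjective e g
  exact ⟨x.toWord, by rw [evalWord, FreeGroup.mk_toWord]⟩

theorem evalWord_append (e : ℕ) (v w : NatWord) :
    evalWord e (v ++ w) = evalWord e v * evalWord e w := by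
  rw [evalWord, ← FreeGroup.mul_mk, map_mul]; rfl

theorem evalWord_invRev (e : ℕ) (w : NatWord) :
    evalWord e (FreeGroup.invRev w) = (evalWord e w)⁻¹ := by
  rw [evalWord, ← FreeGroup.inv_mk, map_inv]; rfl

theorem evalWord_pow (e : ℕ) (w : NatWord) (n : ℕ) :
    evalWord e (NatWord.pow w n) = evalWord e w ^ n := by
  rw [evalWord, NatWord.mk_pow, map_pow]; rfl

theorem evalWord_conj (e : ℕ) (u w : NatWord) :
    evalWord e (NatWord.conj u w) = evalWord e u * evalWord e w * (evalWord e u)⁻¹ := by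
  rw [evalWord, NatWord.mk_conj, map_mul, map_mul, map_inv]; rfl

theorem evalWord_flatten (e : ℕ) (l : List NatWord) :
    evalWord e l.flatten = (l.map (evalWord e)).prod := by
  induction l with
  | nil => exact map_one (evalHom e)
  | cons w l ih => rw [List.flatten_cons, evalWord_append, ih, List.map_cons, List.prod_cons]

end EvalHom

/-! ### Total orders on groups and their positive cones -/

section PositiveCone

variable {G : Type} [Group G]

/-- No nonempty product of conjugates, by elements of `C`, of elements of `P` is trivial. -/
def AvoidsOne (C P : Set G) : Prop :=
  ∀ q : List (G × G), q ≠ [] → (∀ x ∈ q, x.1 ∈ C ∧ x.2 ∈ P) →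
    (q.map fun x => x.1 * x.2 * x.1⁻¹).prod ≠ 1

/-- `P` contains one of `g`, `g⁻¹` for each nontrivial `g`, and avoids one up to conjugation by
elements of `C`. -/
def IsConeFor (C P : Set G) : Prop :=
  (∀ g, g ≠ 1 → g ∈ P ∨ g⁻¹ ∈ P) ∧ AvoidsOne C P

/-- Compactness: the limit of the partial cones `P F` along an ultrafilter refining `atTop` on
finite sets. The ultrafilter decides each sign, and a forbidden product involves only finitely many
elements, so it would already occur in one `P F`. -/
theorem exists_isConeFor {C : Set G}
    (h : ∀ F : Finset G, 1 ∉ F → ∃ P : Set G, (∀ g ∈ F, g ∈ P ∨ g⁻¹ ∈ P) ∧ AvoidsOne C P) :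
    ∃ P : Set G, IsConeFor C P := by
  classical
  choose P hsign havoid using fun F : Finset G => h (F.erase 1) (Finset.notMem_erase 1 F)
  let U : Ultrafilter (Finset G) := Ultrafilter.of Filter.atTop
  refine ⟨{g | ∀ᶠ F in (U : Filter (Finset G)), g ∈ P F}, fun g hg => ?_, fun q hq hqP => ?_⟩
  · refine Ultrafilter.eventually_or.1 ?_
    have : ∀ᶠ F in (U : Filter (Finset G)), {g} ≤ F :=
      (Filter.eventually_ge_atTop ({g} : Finset G)).filter_mono (Ultrafilter.of_le _)
    filter_upwards [this] with F hF
    exact hsign F g (Finset.mem_erase.2 ⟨hg, Finset.singleton_subset_iff.1 hF⟩)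
  · have : ∀ᶠ F in (U : Filter (Finset G)), ∀ x ∈ {x | x ∈ q}, x.2 ∈ P F :=
      (Filter.eventually_all_finite (List.finite_toSet q)).2 fun x hx => (hqP x hx).2
    obtain ⟨F, hF⟩ := this.exists
    exact havoid F q hq fun x hx => ⟨(hqP x hx).1, hF x hx⟩

namespace IsConeFor

variable {C P : Set G}

theorem one_notMem (h : IsConeFor C P) (hC : 1 ∈ C) : (1 : G) ∉ P := fun h1 =>
  h.2 [(1, 1)] (by simp) (by simpa using ⟨hC, h1⟩) (by simp)

/-- If `(a * b)⁻¹` were in `P` instead, then `a * b * (a * b)⁻¹` would be a forbidden product. -/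
theorem mul_mem (h : IsConeFor C P) (hC : 1 ∈ C) {a b : G} (ha : a ∈ P) (hb : b ∈ P) :
    a * b ∈ P := by
  have hab : a * b ≠ 1 := by
    simpa using h.2 [(1, a), (1, b)] (by simp) (by simpa using ⟨⟨hC, ha⟩, hC, hb⟩)
  refine (h.1 _ hab).resolve_right fun hinv => ?_
  exact h.2 [(1, a), (1, b), (1, (a * b)⁻¹)] (by simp)
    (by simpa using ⟨⟨hC, ha⟩, ⟨hC, hb⟩, hC, by simpa using hinv⟩) (by simp)

theorem conj_mem (h : IsConeFor C P) (hC : 1 ∈ C) {a c : G} (hc : c ∈ C) (ha : a ∈ P) :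
    c * a * c⁻¹ ∈ P := by
  have hca : c * a * c⁻¹ ≠ 1 := by
    simpa only [List.map_cons, List.map_nil, List.prod_cons, List.prod_nil, mul_one] using
      h.2 [(c, a)] (by simp) (by simpa using ⟨hc, ha⟩)
  refine (h.1 _ hca).resolve_right fun hinv => ?_
  refine h.2 [(c, a), (1, (c * a * c⁻¹)⁻¹)] (by simp) ?_ (by simp)
  intro x hx
  rcases List.mem_pair.1 hx with rfl | rfl
  exacts [⟨hc, ha⟩, ⟨hC, hinv⟩]

theorem exists_linearOrder (h : IsConeFor C P) (hC : 1 ∈ C) :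
    ∃ o : LinearOrder G, ∀ a b : G, o.le a b ↔ a = b ∨ a⁻¹ * b ∈ P := by
  classical
  refine ⟨{ le := fun a b => a = b ∨ a⁻¹ * b ∈ P
            le_refl := fun a => Or.inl rfl
            le_trans := ?_
            le_antisymm := ?_
            le_total := ?_
            toDecidableLE := Classical.decRel _ }, fun a b => Iff.rfl⟩
  · rintro a b c (rfl | hab) (rfl | hbc)
    · exact Or.inl rfl
    · exact Or.inr hbc
    · exact Or.inr hab
    · exact Or.inr (by simpa [mul_assoc] using h.mul_mem hC hab hbc)
  · rintro a b (rfl | hab) (hba | hba)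
    · rfl
    · rfl
    · exact hba.symm
    · exact absurd (by simpa [mul_assoc] using h.mul_mem hC hab hba) (h.one_notMem hC)
  · intro a b
    by_cases hab : a = b
    · exact Or.inl (Or.inl hab)
    · rcases h.1 (a⁻¹ * b) fun hne => hab (inv_mul_eq_one.1 hne) with hP | hP
      · exact Or.inl (Or.inr hP)
      · exact Or.inr (Or.inr (by simpa using hP))

end IsConeFor

theorem isConeFor_of_linearOrder {C : Set G} [LinearOrder G]
    (hmul : ∀ a g h : G, g ≤ h → a * g ≤ a * h)
    (hconj : ∀ c ∈ C, ∀ a : G, 1 < a → 1 < c * a * c⁻¹) : IsConeFor C {g : G | 1 < g} := by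
  have hlt : ∀ a g h : G, g < h → a * g < a * h := fun a g h hgh =>
    lt_of_le_of_ne (hmul a g h hgh.le) fun heq => hgh.ne (mul_left_cancel heq)
  refine ⟨fun g hg => ?_, fun q hq hqP => ne_of_gt ?_⟩
  · rcases lt_or_gt_of_ne hg with hg | hg
    · exact Or.inr (by simpa using hlt g⁻¹ g 1 hg)
    · exact Or.inl hg
  · induction q with
    | nil => exact absurd rfl hq
    | cons x q ih =>
      have hx : 1 < x.1 * x.2 * x.1⁻¹ :=
        hconj _ (hqP x List.mem_cons_self).1 _ (hqP x List.mem_cons_self).2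
      rw [List.map_cons, List.prod_cons]
      rcases eq_or_ne q [] with rfl | hq'
      · simpa using hx
      · refine hx.trans ?_
        simpa only [mul_one] using
          hlt _ _ _ (ih hq' fun y hy => hqP y (List.mem_cons_of_mem _ hy))

theorem groupIsLeftOrderable_iff : GroupIsLeftOrderable G ↔ ∃ P : Set G, IsConeFor {1} P := by
  constructor
  · rintro ⟨_, hmul⟩
    exact ⟨_, isConeFor_of_linearOrder hmul (by simp)⟩
  · rintro ⟨P, hP⟩
    obtain ⟨o, ho⟩ := hP.exists_linearOrder rfl
    refine ⟨o, fun a g h hgh => (ho _ _).2 (((ho _ _).1 hgh).imp (congrArg _) fun hP => ?_)⟩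
    simpa [mul_assoc] using hP

theorem groupIsBiOrderable_iff : GroupIsBiOrderable G ↔ ∃ P : Set G, IsConeFor Set.univ P := by
  constructor
  · rintro ⟨_, hmul⟩
    refine ⟨_, isConeFor_of_linearOrder (fun a g h hgh => (hmul a g h hgh).1) fun c _ a ha => ?_⟩
    refine lt_of_le_of_ne ?_ fun h => ha.ne (conj_eq_one_iff.1 h.symm).symm
    simpa using (hmul c⁻¹ _ _ (hmul c _ _ ha.le).1).2
  · rintro ⟨P, hP⟩
    obtain ⟨o, ho⟩ := hP.exists_linearOrder (Set.mem_univ _)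
    refine ⟨o, fun a g h hgh => ⟨(ho _ _).2 (((ho _ _).1 hgh).imp (congrArg _) fun h => ?_),
      (ho _ _).2 (((ho _ _).1 hgh).imp (congrArg (· * a)) fun h => ?_)⟩⟩
    · simpa [mul_assoc] using h
    -- `(g * a)⁻¹ * (h * a)` is the conjugate of `g⁻¹ * h` by `a⁻¹`.
    · simpa [mul_assoc] using hP.conj_mem (Set.mem_univ _) (Set.mem_univ a⁻¹) h

end PositiveCone

/-! ### Upper bounds -/

section UpperBounds

open NatWord

theorem detectionIsPiZeroTwo_of_forall_imp {P : (G : Type) → [Group G] → Prop} {β : Type}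
    [Primcodable β] {p q : ℕ × β → Prop} (hp : IsSigmaOne p) (hq : IsSigmaOne q)
    (h : ∀ e, IsRecursivePresentation e → (P (PresGroup e) ↔ ∀ b, p (e, b) → q (e, b))) :
    DetectionIsPiZeroTwo P :=
  ⟨_, isPiZeroTwo_forall_imp hp hq, h⟩

theorem detectionIsPiZeroTwo_of_forall {P : (G : Type) → [Group G] → Prop} {β : Type}
    [Primcodable β] {q : ℕ × β → Prop} (hq : IsSigmaOne q)
    (h : ∀ e, IsRecursivePresentation e → (P (PresGroup e) ↔ ∀ b, q (e, b))) :
    DetectionIsPiZeroTwo P :=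
  ⟨_, isPiZeroTwo_forall hq, h⟩

theorem detectionIsPiZeroTwo_abelian :
    DetectionIsPiZeroTwo (fun G [Group G] => GroupIsAbelian G) := by
  have h : Primrec fun x : ℕ × NatWord × NatWord =>
      (x.1, (x.2.1 ++ x.2.2) ++ FreeGroup.invRev (x.2.2 ++ x.2.1)) :=
    Primrec.pair Primrec.fst (Primrec.list_append.comp
      (Primrec.list_append.comp (Primrec.fst.comp Primrec.snd) (Primrec.snd.comp Primrec.snd))
      (primrec_invRev.comp (Primrec.list_append.comp
        (Primrec.snd.comp Primrec.snd) (Primrec.fst.comp Primrec.snd))))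
  refine detectionIsPiZeroTwo_of_forall (isSigmaOne_isConsequence.comp h) fun e he => ?_
  simp only [he.isConsequence_iff, evalWord_append, evalWord_invRev, mul_inv_eq_one, Prod.forall]
  exact (evalWord_surjective e).forall₂

theorem detectionIsPiZeroTwo_trivial :
    DetectionIsPiZeroTwo (fun G [Group G] => GroupIsTrivial G) := by
  refine detectionIsPiZeroTwo_of_forall isSigmaOne_isConsequence fun e he => ?_
  simp only [he.isConsequence_iff]
  exact (evalWord_surjective e).forall

theorem primrec_pow_succ {α : Type} [Primcodable α] {f : α → ℕ} {g : α → NatWord} {k : α → ℕ}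
    (hf : Primrec f) (hg : Primrec g) (hk : Primrec k) :
    Primrec fun a => (f a, pow (g a) (k a + 1)) :=
  Primrec.pair hf (primrec_pow.comp hg (Primrec.succ.comp hk))

theorem forall_pos_iff {p : ℕ → Prop} : (∀ n, 0 < n → p n) ↔ ∀ n, p (n + 1) :=
  ⟨fun h n => h _ n.succ_pos, fun h n hn => Nat.succ_pred_eq_of_pos hn ▸ h n.pred⟩

theorem exists_pos_iff {p : ℕ → Prop} : (∃ n, 0 < n ∧ p n) ↔ ∃ n, p (n + 1) :=
  ⟨fun ⟨n, hn, h⟩ => ⟨n.pred, (Nat.succ_pred_eq_of_pos hn).symm ▸ h⟩,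
    fun ⟨n, h⟩ => ⟨_, n.succ_pos, h⟩⟩

theorem detectionIsPiZeroTwo_torsionFree :
    DetectionIsPiZeroTwo (fun G [Group G] => GroupIsTorsionFree G) := by
  refine detectionIsPiZeroTwo_of_forall_imp (β := NatWord × ℕ)
    (isSigmaOne_isConsequence.comp (primrec_pow_succ Primrec.fst (Primrec.fst.comp Primrec.snd)
      (Primrec.snd.comp Primrec.snd)))
    (isSigmaOne_isConsequence.comp (Primrec.pair Primrec.fst (Primrec.fst.comp Primrec.snd)))
    fun e he => ?_
  simp only [he.isConsequence_iff, evalWord_pow, Prod.forall, GroupIsTorsionFree, forall_pos_iff]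
  exact (evalWord_surjective e).forall

theorem detectionIsPiZeroTwo_torsion :
    DetectionIsPiZeroTwo (fun G [Group G] => GroupIsTorsion G) := by
  refine detectionIsPiZeroTwo_of_forall (β := NatWord)
    (isSigmaOne_isConsequence.comp (primrec_pow_succ (Primrec.fst.comp Primrec.fst)
      (Primrec.snd.comp Primrec.fst) Primrec.snd)).exists_snd fun e he => ?_
  simp only [he.isConsequence_iff, evalWord_pow, GroupIsTorsion, exists_pos_iff]
  exact (evalWord_surjective e).forall

theorem detectionIsPiZeroTwo_divisible :
    DetectionIsPiZeroTwo (fun G [Group G] => GroupIsDivisible G) := by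
  have h : Primrec fun x : (ℕ × NatWord × ℕ) × NatWord =>
      (x.1.1, pow x.2 (x.1.2.2 + 1) ++ FreeGroup.invRev x.1.2.1) :=
    Primrec.pair (Primrec.fst.comp Primrec.fst) (Primrec.list_append.comp
      (primrec_pow.comp Primrec.snd
        (Primrec.succ.comp (Primrec.snd.comp (Primrec.snd.comp Primrec.fst))))
      (primrec_invRev.comp (Primrec.fst.comp (Primrec.snd.comp Primrec.fst))))
  refine detectionIsPiZeroTwo_of_forall (isSigmaOne_isConsequence.comp h).exists_snd
    fun e he => ?_
  simp only [he.isConsequence_iff, evalWord_pow, evalWord_append, evalWord_invRev,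
    mul_inv_eq_one, Prod.forall, GroupIsDivisible, forall_pos_iff]
  refine (evalWord_surjective e).forall.trans (forall_congr' fun w => forall_congr' fun n => ?_)
  exact (evalWord_surjective e).exists

/-! ### Orderability through finite sign choices. -/

/-- The lists obtained from a list of words by choosing each word or its inverse. -/
def signChoices (l : List NatWord) : List (List NatWord) :=
  l.foldr (fun w ls => ls.map (w :: ·) ++ ls.map (FreeGroup.invRev w :: ·)) [[]]

theorem primrec_signChoices : Primrec signChoices := by
  have h1 : Primrec₂ fun (x : List NatWord × NatWord × List (List NatWord)) (l : List NatWord) =>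
      x.2.1 :: l :=
    (Primrec.list_cons.comp (Primrec.fst.comp (Primrec.snd.comp Primrec.fst)) Primrec.snd).to₂
  have h2 : Primrec₂ fun (x : List NatWord × NatWord × List (List NatWord)) (l : List NatWord) =>
      FreeGroup.invRev x.2.1 :: l :=
    (Primrec.list_cons.comp (primrec_invRev.comp
      (Primrec.fst.comp (Primrec.snd.comp Primrec.fst))) Primrec.snd).to₂
  have hs : Primrec fun x : List NatWord × NatWord × List (List NatWord) => x.2.2 :=
    Primrec.snd.comp Primrec.snd
  exact Primrec.list_foldr Primrec.id (Primrec.const [[]])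
    (Primrec.list_append.comp (Primrec.list_map hs h1) (Primrec.list_map hs h2)).to₂

theorem mem_signChoices_cons {w : NatWord} {l m : List NatWord} :
    m ∈ signChoices (w :: l) ↔
      ∃ m' ∈ signChoices l, w :: m' = m ∨ FreeGroup.invRev w :: m' = m := by
  rw [show signChoices (w :: l) = (signChoices l).map (w :: ·) ++
    (signChoices l).map (FreeGroup.invRev w :: ·) from rfl, List.mem_append, List.mem_map,
    List.mem_map, ← exists_or]
  simp only [and_or_left]

theorem mem_or_invRev_mem_of_mem_signChoices {l m : List NatWord} (hm : m ∈ signChoices l) :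
    ∀ w ∈ l, w ∈ m ∨ FreeGroup.invRev w ∈ m := by
  induction l generalizing m with
  | nil => simp
  | cons v l ih =>
    obtain ⟨m', hm', h⟩ := mem_signChoices_cons.1 hm
    intro w hw
    rcases List.mem_cons.1 hw with rfl | hw
    · rcases h with rfl | rfl
      exacts [Or.inl List.mem_cons_self, Or.inr List.mem_cons_self]
    · rcases h with rfl | rfl <;>
      exact (ih hm' w hw).imp (List.mem_cons_of_mem _) (List.mem_cons_of_mem _)

theorem exists_mem_signChoices {p : NatWord → Prop} {l : List NatWord}
    (h : ∀ w ∈ l, p w ∨ p (FreeGroup.invRev w)) : ∃ m ∈ signChoices l, ∀ w ∈ m, p w := by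
  induction l with
  | nil => exact ⟨[], List.mem_singleton_self _, by simp⟩
  | cons v l ih =>
    obtain ⟨m, hm, hp⟩ := ih fun w hw => h w (List.mem_cons_of_mem _ hw)
    rcases h v List.mem_cons_self with hv | hv
    · exact ⟨_, mem_signChoices_cons.2 ⟨m, hm, Or.inl rfl⟩, List.forall_mem_cons.2 ⟨hv, hp⟩⟩
    · exact ⟨_, mem_signChoices_cons.2 ⟨m, hm, Or.inr rfl⟩, List.forall_mem_cons.2 ⟨hv, hp⟩⟩

/-- The product of the words `t(u) w t(u)⁻¹`, for the pairs `(u, w)` in a list. -/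
def twistedProd (t : NatWord → NatWord) (q : List (NatWord × NatWord)) : NatWord :=
  (q.map fun x => conj (t x.1) x.2).flatten

theorem primrec_twistedProd {t : NatWord → NatWord} (ht : Primrec t) :
    Primrec (twistedProd t) := by
  have h : Primrec fun x : NatWord × NatWord => conj (t x.1) x.2 :=
    primrec_conj.comp (ht.comp Primrec.fst) Primrec.snd
  exact Primrec.list_flatten.comp (Primrec.list_map Primrec.id (h.comp Primrec.snd).to₂)

theorem evalWord_twistedProd (e : ℕ) (t : NatWord → NatWord) (q : List (NatWord × NatWord)) :
    evalWord e (twistedProd t q) =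
      ((q.map fun x => (evalWord e (t x.1), evalWord e x.2)).map
        fun x => x.1 * x.2 * x.1⁻¹).prod := by
  rw [twistedProd, evalWord_flatten, List.map_map, List.map_map]
  simp only [Function.comp_def, evalWord_conj]

/-- In the group with index `e`, some nonempty product of twisted conjugates of the given words
is trivial. -/
def HasTrivialProduct (t : NatWord → NatWord) (x : ℕ × List NatWord) : Prop :=
  ∃ q : List (NatWord × NatWord), (q ≠ [] ∧ ∀ y ∈ q, ∃ w ∈ x.2, w = y.2) ∧
    IsConsequence (x.1, twistedProd t q)

theorem isSigmaOne_hasTrivialProduct {t : NatWord → NatWord} (ht : Primrec t) :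
    IsSigmaOne (HasTrivialProduct t) := by
  have h1 : PrimrecRel fun (y : NatWord × NatWord) (l : List NatWord) => ∃ w ∈ l, w = y.2 :=
    PrimrecRel.comp (PrimrecRel.exists_mem_list (Primrec.eq (α := NatWord)))
      Primrec.snd (Primrec.snd.comp Primrec.fst)
  have h2 : PrimrecPred fun x : (ℕ × List NatWord) × List (NatWord × NatWord) =>
      x.2 ≠ [] ∧ ∀ y ∈ x.2, ∃ w ∈ x.1.2, w = y.2 :=
    (Primrec.eq.comp Primrec.snd (Primrec.const [])).not.and
      (PrimrecRel.comp
        (f := fun x : (ℕ × List NatWord) × List (NatWord × NatWord) => x.2) (g := fun x => x.1.2)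
        h1.forall_mem_list Primrec.snd (Primrec.snd.comp Primrec.fst))
  have h3 : Primrec fun x : (ℕ × List NatWord) × List (NatWord × NatWord) =>
      (x.1.1, twistedProd t x.2) :=
    Primrec.pair (Primrec.fst.comp Primrec.fst) ((primrec_twistedProd ht).comp Primrec.snd)
  exact ((IsSigmaOne.of_primrecPred h2).and (isSigmaOne_isConsequence.comp h3)).exists_snd

/-- The compactness criterion in contrapositive form, so that premise and conclusion are both `Σ⁰₁`.
The function `t` parametrizes the conjugators: a constant empty word gives left orders, the identity
gives bi-orders. -/
theorem IsRecursivePresentation.exists_isConeFor_iff {e : ℕ} (he : IsRecursivePresentation e)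
    {t : NatWord → NatWord} {C : Set (PresGroup e)}
    (hC : ∀ c, c ∈ C ↔ ∃ u, evalWord e (t u) = c) :
    (∃ P, IsConeFor C P) ↔ ∀ l : List NatWord,
      (∀ m ∈ signChoices l, HasTrivialProduct t (e, m)) → ∃ w ∈ l, IsConsequence (e, w) := by
  simp only [HasTrivialProduct, he.isConsequence_iff, exists_eq_right, evalWord_twistedProd]
  constructor
  · rintro ⟨P, hP, havoid⟩ l hl
    by_contra! hne
    obtain ⟨m, hm, hmP⟩ := exists_mem_signChoices (p := fun w => evalWord e w ∈ P)
      fun w hw => by simpa only [evalWord_invRev] using hP _ (hne w hw)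
    obtain ⟨q, ⟨hq, hqm⟩, hprod⟩ := hl m hm
    refine havoid _ (by simpa using hq) ?_ hprod
    simp only [List.forall_mem_map]
    exact fun x hx => ⟨(hC _).2 ⟨_, rfl⟩, hmP _ (hqm x hx)⟩
  · intro h
    refine exists_isConeFor fun F hF => ?_
    obtain ⟨l, hl⟩ := List.map_surjective_iff.2 (evalWord_surjective e) F.toList
    have hmem : ∀ g, g ∈ F ↔ ∃ w ∈ l, evalWord e w = g := fun g => by
      rw [← Finset.mem_toList, ← hl, List.mem_map]
    have hl' : ¬ ∃ w ∈ l, evalWord e w = 1 := fun hw => hF ((hmem 1).2 hw)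
    -- As no word of `l` is trivial, some choice of signs `m` has no trivial product; the elements
    -- represented by `m` form the partial cone.
    have hl'' := mt (h l) hl'
    push Not at hl''
    obtain ⟨m, hm, hm'⟩ := hl''
    refine ⟨{g | ∃ w ∈ m, evalWord e w = g}, fun g hg => ?_, fun q hq hqm hprod => ?_⟩
    · obtain ⟨w, hw, rfl⟩ := (hmem g).1 hg
      exact (mem_or_invRev_mem_of_mem_signChoices hm w hw).imp (fun h => ⟨w, h, rfl⟩)
        fun h => ⟨_, h, evalWord_invRev e w⟩
    · have hlift : ∀ x ∈ q, ∃ y : NatWord × NatWord, y.2 ∈ m ∧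
          (evalWord e (t y.1), evalWord e y.2) = x := by
        rintro ⟨c, g⟩ hx
        obtain ⟨u, hu⟩ := (hC c).1 (hqm _ hx).1
        obtain ⟨w, hw, hwg⟩ := (hqm _ hx).2
        exact ⟨(u, w), hw, Prod.ext hu hwg⟩
      choose! f hfm hf using hlift
      refine hm' (q.map f) ⟨by simpa using hq, List.forall_mem_map.2 hfm⟩ ?_
      have hmap : (q.map f).map (fun y => (evalWord e (t y.1), evalWord e y.2)) = q := by
        rw [List.map_map]
        exact (List.map_congr_left hf).trans (List.map_id q)
      rwa [hmap]

theorem detectionIsPiZeroTwo_of_isConeFor {P : (G : Type) → [Group G] → Prop}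
    {C : (G : Type) → [Group G] → Set G} {t : NatWord → NatWord} (ht : Primrec t)
    (hC : ∀ e c, c ∈ C (PresGroup e) ↔ ∃ u, evalWord e (t u) = c)
    (hP : ∀ (G : Type) [Group G], P G ↔ ∃ T, IsConeFor (C G) T) : DetectionIsPiZeroTwo P := by
  have h1 : IsSigmaOne fun x : ℕ × List NatWord =>
      ∀ m ∈ signChoices x.2, HasTrivialProduct t (x.1, m) :=
    IsSigmaOne.forall_mem_list (p := fun x : (ℕ × List NatWord) × List NatWord =>
      HasTrivialProduct t (x.1.1, x.2)) ((isSigmaOne_hasTrivialProduct ht).comp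
        (Primrec.pair (Primrec.fst.comp Primrec.fst) Primrec.snd))
      (primrec_signChoices.comp Primrec.snd)
  have h2 : IsSigmaOne fun x : ℕ × List NatWord => ∃ w ∈ x.2, IsConsequence (x.1, w) :=
    IsSigmaOne.exists_mem_list (p := fun x : (ℕ × List NatWord) × NatWord =>
      IsConsequence (x.1.1, x.2)) (isSigmaOne_isConsequence.comp
        (Primrec.pair (Primrec.fst.comp Primrec.fst) Primrec.snd)) Primrec.snd
  exact detectionIsPiZeroTwo_of_forall_imp h1 h2 fun e he =>
    (hP _).trans (he.exists_isConeFor_iff (hC e))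

theorem detectionIsPiZeroTwo_leftOrderable :
    DetectionIsPiZeroTwo (fun G [Group G] => GroupIsLeftOrderable G) :=
  detectionIsPiZeroTwo_of_isConeFor (C := fun G [Group G] => {1}) (Primrec.const [])
    (fun e c => by
      rw [Set.mem_singleton_iff, exists_const, eq_comm]
      exact Iff.of_eq (congrArg (· = c) (map_one (evalHom e)).symm))
    fun _ _ => groupIsLeftOrderable_iff

theorem detectionIsPiZeroTwo_biOrderable :
    DetectionIsPiZeroTwo (fun G [Group G] => GroupIsBiOrderable G) :=
  detectionIsPiZeroTwo_of_isConeFor (C := fun G [Group G] => Set.univ) Primrec.id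
    (fun e c => by simpa using evalWord_surjective e c)
    fun _ _ => groupIsBiOrderable_iff

end UpperBounds

/-! ### Hardness -/

section Hardness

open Nat.Partrec (Code)
open Nat.Partrec.Code

/-- A uniformly computably enumerable family of sets of relators on the generating set `ℕ` is
given by a computable family of indices of presentations. -/
theorem exists_computable_index {c : (ℕ × ℕ) × ℕ → Bool} (hc : Computable c) :
    ∃ f : ℕ → ℕ, Computable f ∧ ∀ e, (∀ n, 1 ∈ phi (f e).unpair.1 n) ∧
      ceSet (f e).unpair.2 = {m | ∃ z, c ((e, m), z) = true} := by
  -- The unbounded search for `z` halts exactly on the members of the set; currying its code (s-m-n)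
  -- makes the index computable in `e`.
  have hp : Partrec fun n : ℕ => Nat.rfind fun z => Part.some (c (n.unpair, z)) :=
    (Partrec.rfind (p := fun a z => Part.some (c (a, z))) hc.partrec.to₂).comp
      Primrec.unpair.to_comp
  obtain ⟨k, hk⟩ := exists_code.1 (Partrec.nat_iff.1 hp)
  refine ⟨fun e => Nat.pair (Encodable.encode (Code.const 1)) (Encodable.encode (curry k e)),
    (Primrec₂.natPair.comp (Primrec.const _) (Primrec.encode.comp
      (primrec₂_curry.comp (Primrec.const k) Primrec.id))).to_comp, fun e => ⟨fun n => ?_, ?_⟩⟩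
  · rw [Nat.unpair_pair, phi, Denumerable.ofNat_encode, eval_const]
    exact Part.mem_some 1
  · ext m
    have hkm : k.eval (Nat.pair e m) = Nat.rfind fun z => Part.some (c ((e, m), z)) := by
      rw [hk]
      beta_reduce
      rw [Nat.unpair_pair]
    rw [Nat.unpair_pair, ceSet, phi, Denumerable.ofNat_encode, Set.mem_ofPred_eq, eval_curry, hkm]
    refine Nat.rfind_dom.trans ⟨fun ⟨z, hz, _⟩ => ⟨z, (Part.mem_some_iff.1 hz).symm⟩,
      fun ⟨z, hz⟩ => ⟨z, Part.mem_some_iff.2 hz.symm, fun _ => trivial⟩⟩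

/-- The relator check for the presentation with generators `n`, with `n = 1` if there is `y` with
`r (e, n / 2, y)`, and with `n ^ 2 = 1` if `n` is odd. -/
def pairCheck (r : ℕ × ℕ × ℕ → Bool) (x : (ℕ × ℕ) × ℕ) : Bool :=
  (decide (x.1.2 = Encodable.encode [(x.2.unpair.1, true)]) &&
      r (x.1.1, x.2.unpair.1 / 2, x.2.unpair.2)) ||
    (decide (x.1.2 = Encodable.encode [(x.2.unpair.1, true), (x.2.unpair.1, true)]) &&
      decide (x.2.unpair.1 % 2 = 1))

theorem computable_pairCheck {r : ℕ × ℕ × ℕ → Bool} (hr : Computable r) :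
    Computable (pairCheck r) := by
  have hm : Primrec fun x : (ℕ × ℕ) × ℕ => x.1.2 := Primrec.snd.comp Primrec.fst
  have hn : Primrec fun x : (ℕ × ℕ) × ℕ => x.2.unpair.1 :=
    Primrec.fst.comp (Primrec.unpair.comp Primrec.snd)
  have hl : Primrec fun x : (ℕ × ℕ) × ℕ => (x.2.unpair.1, true) :=
    Primrec.pair hn (Primrec.const true)
  have h1 : Primrec fun x : (ℕ × ℕ) × ℕ => [(x.2.unpair.1, true)] :=
    Primrec.list_cons.comp hl (Primrec.const [])
  have h2 : Primrec fun x : (ℕ × ℕ) × ℕ => [(x.2.unpair.1, true), (x.2.unpair.1, true)] :=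
    Primrec.list_cons.comp hl h1
  have h3 : Primrec fun x : (ℕ × ℕ) × ℕ => (x.1.1, x.2.unpair.1 / 2, x.2.unpair.2) :=
    Primrec.pair (Primrec.fst.comp Primrec.fst) (Primrec.pair
      (Primrec.nat_div.comp hn (Primrec.const 2))
      (Primrec.snd.comp (Primrec.unpair.comp Primrec.snd)))
  have c1 := (Primrec.eq.comp hm (Primrec.encode.comp h1)).decide
  have c2 := (Primrec.eq.comp hm (Primrec.encode.comp h2)).decide
  have c3 := (Primrec.eq.comp (Primrec.nat_mod.comp hn (Primrec.const 2))
    (Primrec.const 1)).decide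
  exact Primrec.or.to_comp.comp (Primrec.and.to_comp.comp c1.to_comp (hr.comp h3.to_comp))
    (Primrec.and.comp c2 c3).to_comp

theorem exists_pairCheck_iff {r : ℕ × ℕ × ℕ → Bool} {e m : ℕ} :
    (∃ z, pairCheck r ((e, m), z) = true) ↔ ∃ n,
      (m = Encodable.encode [(n, true)] ∧ ∃ y, r (e, n / 2, y) = true) ∨
      (m = Encodable.encode [(n, true), (n, true)] ∧ n % 2 = 1) := by
  constructor
  · rintro ⟨z, hz⟩
    simp only [pairCheck, Bool.or_eq_true, Bool.and_eq_true, decide_eq_true_eq] at hz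
    exact ⟨_, hz.imp_left fun h => ⟨h.1, _, h.2⟩⟩
  · rintro ⟨n, ⟨hm, y, hy⟩ | ⟨hm, hn⟩⟩
    · exact ⟨Nat.pair n y, by simp [pairCheck, hm, hy]⟩
    · exact ⟨Nat.pair n 0, by simp [pairCheck, hm, hn]⟩

theorem lift_comp_val_mk {X : Set ℕ} {H : Type} [Group H] (F : ℕ → H) (w : List (X × Bool)) :
    FreeGroup.lift (fun x : X => F x) (FreeGroup.mk w) =
      FreeGroup.lift F (FreeGroup.mk (w.map fun l => ((l.1 : ℕ), l.2))) := by
  rw [FreeGroup.lift_mk, FreeGroup.lift_mk, List.map_map]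
  rfl

/-- A property of groups which holds for trivial groups, and fails for groups with elements `a`
and `b`, `b ^ 2 = 1`, such that all such pairs of elements in other groups are their images, is
`Π⁰₂`-hard to detect. -/
theorem detectionIsPiZeroTwoHard_of_universal {P : (G : Type) → [Group G] → Prop}
    (htriv : ∀ (G : Type) [Group G], (∀ g : G, g = 1) → P G)
    (hpair : ∀ (G : Type) [Group G] (a b : G), b ^ 2 = 1 →
      (∀ (H : Type) [Group H] (h k : H), k ^ 2 = 1 → ∃ φ : G →* H, φ a = h ∧ φ b = k) → ¬ P G) :
    DetectionIsPiZeroTwoHard P := by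
  rintro S ⟨R, hR, hS⟩
  obtain ⟨r, hr, rfl⟩ := ComputablePred.computable_iff.1 hR
  obtain ⟨f, hf, hfe⟩ := exists_computable_index (computable_pairCheck hr)
  have hgen : ∀ e n, n ∈ presGenerators (f e) := fun e => (hfe e).1
  have hrel : ∀ e m, m ∈ ceSet (f e).unpair.2 ↔ _ := fun e m => by
    rw [(hfe e).2, Set.mem_ofPred_eq, exists_pairCheck_iff]
  have hone : ∀ e n, (∃ y, r (e, n / 2, y) = true) →
      (PresentedGroup.of ⟨n, hgen e n⟩ : PresGroup (f e)) = 1 := fun e n hy =>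
    PresentedGroup.one_of_mem (rels := presRelators (f e))
      ⟨[(⟨n, hgen e n⟩, true)], (hrel e _).2 ⟨n, Or.inl ⟨rfl, hy⟩⟩, rfl⟩
  refine ⟨f, hf, fun e => ⟨fun n => Or.inr ((hfe e).1 n), fun m hm => ?_⟩, fun e => ?_⟩
  · obtain ⟨n, ⟨rfl, -⟩ | ⟨rfl, -⟩⟩ := (hrel e m).1 hm
    · exact ⟨[(⟨n, hgen e n⟩, true)], rfl⟩
    · exact ⟨[(⟨n, hgen e n⟩, true), (⟨n, hgen e n⟩, true)], rfl⟩
  · by_cases he : e ∈ S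
    · refine iff_of_true he (htriv _ fun g => ?_)
      have h1 : MonoidHom.id (PresGroup (f e)) = 1 :=
        PresentedGroup.ext fun n => hone e n ((hS e).1 he _)
      exact DFunLike.congr_fun h1 g
    · refine iff_of_false he ?_
      -- For this `x` the search never succeeds, so the generators `2x` and `2x + 1` are never
      -- killed.
      obtain ⟨x, hx⟩ : ∃ x, ∀ y, ¬ r (e, x, y) = true := by
        simpa only [not_forall, not_exists] using mt (hS e).2 he
      refine hpair _ (PresentedGroup.of ⟨2 * x, hgen e _⟩)
        (PresentedGroup.of ⟨2 * x + 1, hgen e _⟩) ?_ ?_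
      · rw [pow_two]
        exact PresentedGroup.one_of_mem (rels := presRelators (f e))
          ⟨[(⟨2 * x + 1, hgen e _⟩, true), (⟨2 * x + 1, hgen e _⟩, true)],
            (hrel e _).2 ⟨2 * x + 1, Or.inr ⟨rfl, by omega⟩⟩, rfl⟩
      · intro H _ h k hk
        -- All other generators go to `1`. A relator `n` has `n / 2 ≠ x`, so it avoids the surviving
        -- pair; the only square relator in the pair is that of `2x + 1`, respected because `k ^ 2 =
        -- 1`.
        let F : ℕ → H := fun n => if n = 2 * x then h else if n = 2 * x + 1 then k else 1
        have hF : ∀ w ∈ presRelators (f e), FreeGroup.lift (fun n => F n.1) w = 1 := by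
          rintro _ ⟨w, hw, rfl⟩
          rw [lift_comp_val_mk]
          obtain ⟨n, ⟨hw, y, hy⟩ | ⟨hw, hn⟩⟩ := (hrel e _).1 hw
          · have hn : n / 2 ≠ x := fun h => hx y (h ▸ hy)
            rw [Encodable.encode_injective hw, FreeGroup.lift_mk]
            simp [F, show n ≠ 2 * x by omega, show n ≠ 2 * x + 1 by omega]
          · rw [Encodable.encode_injective hw, FreeGroup.lift_mk]
            by_cases hnx : n = 2 * x + 1
            · simpa [F, hnx, pow_two] using hk
            · simp [F, show n ≠ 2 * x by omega, hnx]
        exact ⟨PresentedGroup.toGroup hF, (PresentedGroup.toGroup.of hF).trans (if_pos rfl),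
          (PresentedGroup.toGroup.of hF).trans (by simp [F])⟩

/-! ### Failure of each property in the presence of a universal pair. -/

variable {G : Type} [Group G]

theorem ne_one_of_universal {b : G}
    (h : ∀ (H : Type) [Group H] (k : H), k ^ 2 = 1 → ∃ φ : G →* H, φ b = k) : b ≠ 1 := by
  rintro rfl
  obtain ⟨φ, hφ⟩ := h (Multiplicative (ZMod 2)) (Multiplicative.ofAdd 1) (by decide)
  rw [map_one] at hφ
  exact absurd hφ (by decide)

/-- One of `g`, `g⁻¹` is in the cone, and its `n`-th power is a product of `n` cone elements, hence
not `1`. -/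
theorem GroupIsLeftOrderable.groupIsTorsionFree (h : GroupIsLeftOrderable G) :
    GroupIsTorsionFree G := by
  obtain ⟨P, hP⟩ := groupIsLeftOrderable_iff.1 h
  intro g n hn hgn
  by_contra hg
  have key : ∀ x ∈ P, x ^ n ≠ 1 := fun x hx => by
    have := hP.2 (List.replicate n (1, x)) (by simpa using hn.ne')
      (fun y hy => by rw [List.eq_of_mem_replicate hy]; exact ⟨rfl, hx⟩)
    simpa using this
  rcases hP.1 g hg with hgP | hgP
  · exact key _ hgP hgn
  · exact key _ hgP (by rw [inv_pow, hgn, inv_one])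

theorem GroupIsBiOrderable.groupIsLeftOrderable (h : GroupIsBiOrderable G) :
    GroupIsLeftOrderable G :=
  h.imp fun _ h a g k hgk => (h a g k hgk).1

theorem detectionIsPiZeroTwoHard_abelian :
    DetectionIsPiZeroTwoHard (fun G [Group G] => GroupIsAbelian G) := by
  refine detectionIsPiZeroTwoHard_of_universal (fun G _ h a b => by rw [h a, h b]) ?_
  intro G _ a b _ huniv hP
  -- Two noncommuting transpositions in `S₃`; the image of `b` has to be an involution.
  obtain ⟨φ, ha, hb⟩ := huniv (Equiv.Perm (Fin 3)) (Equiv.swap 0 1) (Equiv.swap 1 2) (by decide)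
  have := congrArg φ (hP a b)
  rw [map_mul, map_mul, ha, hb] at this
  exact absurd this (by decide)

/-- A property of groups which holds for trivial groups and implies torsion-freeness is
`Π⁰₂`-hard to detect. -/
theorem detectionIsPiZeroTwoHard_of_torsionFree {P : (G : Type) → [Group G] → Prop}
    (htriv : ∀ (G : Type) [Group G], (∀ g : G, g = 1) → P G)
    (htf : ∀ (G : Type) [Group G], P G → GroupIsTorsionFree G) : DetectionIsPiZeroTwoHard P := by
  refine detectionIsPiZeroTwoHard_of_universal htriv fun G _ a b hb huniv hP => ?_
  exact ne_one_of_universal (fun H _ k hk => (huniv H 1 k hk).imp fun _ h => h.2)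
    (htf G hP b 2 two_pos hb)

theorem groupIsBiOrderable_of_trivial (h : ∀ g : G, g = 1) : GroupIsBiOrderable G := by
  have : Subsingleton G := ⟨fun a b => (h a).trans (h b).symm⟩
  exact groupIsBiOrderable_iff.2 ⟨∅, fun g hg => absurd (h g) hg, fun q hq hqP => by
    obtain ⟨x, hx⟩ := List.exists_mem_of_ne_nil q hq
    exact absurd (hqP x hx).2 (Set.notMem_empty _)⟩

theorem detectionIsPiZeroTwoHard_divisible :
    DetectionIsPiZeroTwoHard (fun G [Group G] => GroupIsDivisible G) := by
  refine detectionIsPiZeroTwoHard_of_universal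
    (fun G _ h g n _ => ⟨1, by rw [one_pow, h g]⟩) fun G _ a b _ huniv hP => ?_
  -- A square root of `a` would map to half of `1` in `ℤ`.
  obtain ⟨φ, ha, -⟩ := huniv (Multiplicative ℤ) (Multiplicative.ofAdd 1) 1 (one_pow 2)
  obtain ⟨c, hc⟩ := hP a 2 two_pos
  have := congrArg Multiplicative.toAdd ((map_pow φ c 2).symm.trans ((congrArg φ hc).trans ha))
  rw [toAdd_pow, toAdd_ofAdd, nsmul_eq_mul] at this
  omega

theorem detectionIsPiZeroTwoHard_torsion :
    DetectionIsPiZeroTwoHard (fun G [Group G] => GroupIsTorsion G) := by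
  refine detectionIsPiZeroTwoHard_of_universal
    (fun G _ h g => ⟨1, one_pos, h _⟩) fun G _ a b _ huniv hP => ?_
  obtain ⟨φ, ha, -⟩ := huniv (Multiplicative ℤ) (Multiplicative.ofAdd 1) 1 (one_pow 2)
  obtain ⟨n, hn, han⟩ := hP a
  have := congrArg Multiplicative.toAdd (congrArg φ han)
  rw [map_pow, ha, map_one φ, toAdd_pow, toAdd_ofAdd, toAdd_one, nsmul_eq_mul, mul_one] at this
  omega

end Hardness

theorem mainTheorem3 :
    DetectionIsPiZeroTwoComplete (fun G [Group G] => GroupIsAbelian G) ∧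
    DetectionIsPiZeroTwoComplete (fun G [Group G] => GroupIsTorsionFree G) ∧
    DetectionIsPiZeroTwoComplete (fun G [Group G] => GroupIsTrivial G) ∧
    DetectionIsPiZeroTwoComplete (fun G [Group G] => GroupIsDivisible G) ∧
    DetectionIsPiZeroTwoComplete (fun G [Group G] => GroupIsTorsion G) ∧
    DetectionIsPiZeroTwoComplete (fun G [Group G] => GroupIsLeftOrderable G) ∧
    DetectionIsPiZeroTwoComplete (fun G [Group G] => GroupIsBiOrderable G) :=
  ⟨⟨detectionIsPiZeroTwo_abelian, detectionIsPiZeroTwoHard_abelian⟩,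
    ⟨detectionIsPiZeroTwo_torsionFree,
      detectionIsPiZeroTwoHard_of_torsionFree (fun _ _ h g _ _ _ => h g) fun _ _ h => h⟩,
    -- Triviality implies torsion-freeness, so the surviving involution refutes it as well.
    ⟨detectionIsPiZeroTwo_trivial,
      detectionIsPiZeroTwoHard_of_torsionFree (fun _ _ h => h) fun _ _ h g _ _ _ => h g⟩,
    ⟨detectionIsPiZeroTwo_divisible, detectionIsPiZeroTwoHard_divisible⟩,
    ⟨detectionIsPiZeroTwo_torsion, detectionIsPiZeroTwoHard_torsion⟩,
    ⟨detectionIsPiZeroTwo_leftOrderable, detectionIsPiZeroTwoHard_of_torsionFree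
      (fun _ _ h => (groupIsBiOrderable_of_trivial h).groupIsLeftOrderable)
      fun _ _ h => h.groupIsTorsionFree⟩,
    ⟨detectionIsPiZeroTwo_biOrderable, detectionIsPiZeroTwoHard_of_torsionFree
      (fun _ _ h => groupIsBiOrderable_of_trivial h)
      fun _ _ h => h.groupIsLeftOrderable.groupIsTorsionFree⟩⟩
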